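/- Let $\kappa_1,\dots,\kappa_5\in\mathbb{N}\cup\{\infty\}$. In a plane graph $G$ (a finite simple graph, not necessarily connected, drawn in the plane without crossings), a $\langle\kappa_1,\kappa_2,\kappa_3,\kappa_4,\kappa_5\rangle$-star consists of a vertex $v$ of degree $5$ (the center) together with its five neighbours, where the neighbours can be named $v_1,\dots,v_5$ in the cyclic order in which they appear around $v$ in the drawing (starting from any of them, clockwise or counterclockwise) so that $\deg_G(v_i)\le\kappa_i$ for $i=1,\dots,5$. **Theorem.** If $G$ is a plane graph with minimum degree five, then $G$ contains at least one of the following $34$ types of stars: $$\begin{array}{l} \langle 5,7,7,5,17\rangle,\ \langle 5,7,8,5,11\rangle,\ \langle 5,7,5,8,8\rangle,\ \langle 8,5,5,11,6\rangle,\ \langle 8,5,5,8,7\rangle,\ \langle 8,5,5,7,8\rangle,\\ \langle 8,5,5,6,9\rangle,\ \langle 5,6,5,8,11\rangle,\ \langle 5,6,6,5,\infty\rangle,\ \langle 5,6,6,6,17\rangle,\ \langle 6,6,6,6,11\rangle,\ \langle 6,6,6,7,8\rangle,\\ \langle 6,6,7,6,8\rangle,\ \langle 5,6,6,11,7\rangle,\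 \langle 5,6,11,6,7\rangle,\ \langle 5,6,6,8,8\rangle,\ \langle 5,6,8,6,8\rangle,\ \langle 5,7,6,8,7\rangle,\\ \langle 5,6,7,7,7\rangle,\ \langle 5,6,6,7,11\rangle,\ \langle 5,6,7,6,11\rangle,\ \langle 5,7,6,7,8\rangle,\ \langle 5,7,7,6,8\rangle,\ \langle 5,7,6,6,14\rangle,\\ \langle 5,8,6,6,11\rangle,\ \langle 5,5,7,6,14\rangle,\ \langle 5,6,7,5,35\rangle,\ \langle 5,6,8,5,15\rangle,\ \langle 5,6,9,5,10\rangle,\ \langle 5,6,11,5,9\rangle,\\ \langle 5,5,10,5,12\rangle,\ \langle 5,7,11,5,8\rangle,\ \langle 5,6,5,7,14\rangle,\ \langle 5,5,9,5,17\rangle. \end{array}$$ -/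

import Mathlib

/-- A rotation system on a simple graph `G`: for each vertex `v`, a cyclic order of the edges
incident with `v`.  A dart is an edge together with a direction, and `d.fst` is the tail of the
dart `d`; the permutation `rot` sends every dart `v → w` to the next dart out of `v`, and the darts
out of one vertex form one cycle of `rot`. -/
structure RotationSystem {V : Type*} (G : SimpleGraph V) where
  rot : Equiv.Perm G.Dart
  fst_rot : ∀ d : G.Dart, (rot d).fst = d.fst
  sameCycle_rot : ∀ d e : G.Dart, d.fst = e.fst → rot.SameCycle d e

namespace RotationSystem

variable {V : Type*} {G : SimpleGraph V}

/-- The face-tracing permutation: walk along the dart `u → v`, then leave `v` along the edge that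
follows the edge `v u` in the rotation at `v`. -/
def facePerm (R : RotationSystem G) : Equiv.Perm G.Dart :=
  (Function.Involutive.toPerm SimpleGraph.Dart.symm SimpleGraph.Dart.symm_involutive).trans R.rot

/-- The number of facial walks: the orbits of the face-tracing permutation, and for each isolated
vertex the trivial walk at this vertex. -/
noncomputable def numFacialWalks (R : RotationSystem G) : ℕ :=
  Nat.card (Quotient (Equiv.Perm.SameCycle.setoid R.facePerm)) +
    Nat.card {v : V // ∀ w : V, ¬ G.Adj v w}

/-- The Euler genus of the rotation system of a finite graph: the sum, over the connected components
`H`, of the Euler genus `2 - (|V(H)| - |E(H)| + |F(H)|)` of the closed orientable surface that arises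
from `H` when a disc is glued to each facial walk of `H`.  Every summand is a nonnegative
integer, and it is `0` exactly if the surface is the sphere. -/
noncomputable def eulerGenus (R : RotationSystem G) : ℤ :=
  2 * (Nat.card G.ConnectedComponent : ℤ) -
    ((Nat.card V : ℤ) - (Nat.card G.edgeSet : ℤ) + (R.numFacialWalks : ℤ))

/-- `R` has a `⟨κ 0, κ 1, κ 2, κ 3, κ 4⟩`-star: a vertex `d.fst` of degree five whose five neighbours,
listed in their cyclic order (in one of the two directions) from a suitable first neighbour `d.snd`,
have degrees at most `κ 0, κ 1, κ 2, κ 3, κ 4`. -/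
def HasStar [G.LocallyFinite] (R : RotationSystem G) (κ : Fin 5 → ℕ∞) : Prop :=
  ∃ d : G.Dart, G.degree d.fst = 5 ∧
    ((∀ i : Fin 5, (G.degree ((R.rot ^ (i : ℕ)) d).snd : ℕ∞) ≤ κ i) ∨
      (∀ i : Fin 5, (G.degree ((R.rot⁻¹ ^ (i : ℕ)) d).snd : ℕ∞) ≤ κ i))

end RotationSystem

/-- A plane graph structure on a finite simple graph `G`, as a combinatorial map: the rotation system
of a drawing in the plane, that is, one for which every component of `G` is embedded in the
sphere.  `G` need not be connected. -/
structure PlaneGraph {V : Type*} (G : SimpleGraph V) extends RotationSystem G where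
  eulerGenus_eq_zero : toRotationSystem.eulerGenus = 0

/-- The 34 types of stars. -/
def starTypes : List (Fin 5 → ℕ∞) :=
  [![5, 7, 7, 5, 17], ![5, 7, 8, 5, 11], ![5, 7, 5, 8, 8], ![8, 5, 5, 11, 6], ![8, 5, 5, 8, 7],
   ![8, 5, 5, 7, 8], ![8, 5, 5, 6, 9], ![5, 6, 5, 8, 11], ![5, 6, 6, 5, ⊤], ![5, 6, 6, 6, 17],
   ![6, 6, 6, 6, 11], ![6, 6, 6, 7, 8], ![6, 6, 7, 6, 8], ![5, 6, 6, 11, 7], ![5, 6, 11, 6, 7],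
   ![5, 6, 6, 8, 8], ![5, 6, 8, 6, 8], ![5, 7, 6, 8, 7], ![5, 6, 7, 7, 7], ![5, 6, 6, 7, 11],
   ![5, 6, 7, 6, 11], ![5, 7, 6, 7, 8], ![5, 7, 7, 6, 8], ![5, 7, 6, 6, 14], ![5, 8, 6, 6, 11],
   ![5, 5, 7, 6, 14], ![5, 6, 7, 5, 35], ![5, 6, 8, 5, 15], ![5, 6, 9, 5, 10], ![5, 6, 11, 5, 9],
   ![5, 5, 10, 5, 12], ![5, 7, 11, 5, 8], ![5, 6, 5, 7, 14], ![5, 5, 9, 5, 17]]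

/-!
The proof is by discharging in a triangulation.

*Triangulating.* The rotation system is turned into a combinatorial map (`CombMap`) in which
multiple edges and loops are allowed. A facial walk of length at least four can then always be cut
by a chord, and this only increases degrees: a vertex that still has degree five afterwards was
not touched, and its neighbours had at most their new degrees before
(`CombMap.HasStar.of_addChord`). So one may assume that all faces are triangles
(`CombMap.exists_hasStar_of_triangulated`), and Euler's formula gives fewer than `6 |V|` darts;
that is, the charges `deg v - 6` have a negative sum. It does not matter whether the map is
connected.

*Discharging.* Only vertices of degree five have negative charge, namely `-1`. A vertex `w` of
degree `d ≥ 8` (`d ≠ 11, 13`) has about `(d - 6) / d` to give for each edge; the part that belongs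
to a neighbour of degree at least six goes half and half to the next neighbours on either side. So
`w` never sends too much (`Discharging.sum_ringGift_le_share`). For `d = 7, 11, 13` this is
slightly too little, but these numbers are odd, so that the tightest configurations, which
alternate around `w`, cannot close up. The tables `gift7`, `gift11` and `gift13` exploit this, and
`Discharging.sum_ringGift_le_special` bounds the sums by a search for the best closed walk of
length `d` through the possible neighbourhoods.

If no star exists, then a finite search (`Discharging.inflow_sufficient`) shows that a vertex of
degree five receives enough, except if its neighbours have the degrees `d, 5, 8, 5, 5` with `18 ≤
d ≤ 35`, or `13, 5, 10, 5, 5`, or `14, 5, 10, 5, 5`, in one of the two cyclic orders. In these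
cases the two adjacent `5`-neighbours `a` (next to the largest degree) and `b` help out. If the remaining
neighbour of `b` next to the `8` or `10` is not of degree five, then `b` has charge to spare.
Otherwise the absence of stars forces the other common neighbour of `a` and `b` to be so large
that `a` has charge to spare (`CombMap.scarce_inflow`).
-/

/-! ### Combinatorial maps -/

/-- A combinatorial map with darts `D`, vertices `V` and faces `F`: `flip` reverses a dart and
`next` is the next dart around its tail `vert`. In contrast to `RotationSystem`, multiple edges and
loops are allowed, so that faces can always be cut by chords. The labels in `F` of the facial
walks, the orbits of `next ∘ flip`, need not be distinct. -/
structure CombMap (D V F : Type*) where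
  flip : Equiv.Perm D
  next : Equiv.Perm D
  flip_flip : ∀ x, flip (flip x) = x
  vert : D → V
  vert_eq_iff : ∀ x y, vert x = vert y ↔ next.SameCycle x y
  vert_surjective : Function.Surjective vert
  face : D → F
  face_next_flip : ∀ x, face (next (flip x)) = face x
  face_surjective : Function.Surjective face

namespace CombMap

variable {D V F : Type*} (M : CombMap D V F)

/-- The next dart of the facial walk. -/
def phi (x : D) : D := M.next (M.flip x)

theorem phi_injective : Function.Injective M.phi :=
  M.next.injective.comp M.flip.injective

theorem face_phi (x : D) : M.face (M.phi x) = M.face x := M.face_next_flip x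

theorem vert_next (x : D) : M.vert (M.next x) = M.vert x :=
  (M.vert_eq_iff _ _).2 (Equiv.Perm.sameCycle_apply_left.2 (Equiv.Perm.SameCycle.refl _ _))

theorem vert_next_symm (x : D) : M.vert (M.next⁻¹ x) = M.vert x := by
  conv_rhs => rw [← M.next.apply_symm_apply x, M.vert_next]
  rfl

theorem vert_next_pow (n : ℕ) (x : D) : M.vert ((M.next ^ n) x) = M.vert x :=
  (M.vert_eq_iff _ _).2 (Equiv.Perm.sameCycle_pow_left.2 (Equiv.Perm.SameCycle.refl _ _))

/-- The degree of the tail of a dart. -/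
noncomputable def deg (x : D) : ℕ := Nat.card {y // M.vert y = M.vert x}

theorem deg_congr {x y : D} (h : M.vert x = M.vert y) : M.deg x = M.deg y := by
  unfold deg; rw [h]

/-- The degree of the head of a dart. -/
noncomputable def headDeg (x : D) : ℕ := M.deg (M.flip x)

/-- There is a star with degree bounds `κ`; compare `RotationSystem.HasStar`. -/
def HasStar (κ : Fin 5 → ℕ∞) : Prop :=
  ∃ x, M.deg x = 5 ∧
    ((∀ i : Fin 5, (M.headDeg ((M.next ^ (i : ℕ)) x) : ℕ∞) ≤ κ i) ∨
      (∀ i : Fin 5, (M.headDeg ((M.next⁻¹ ^ (i : ℕ)) x) : ℕ∞) ≤ κ i))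

/-- The properties kept when chords are added: all degrees are at least five, all facial walks have
length at least three, and the Euler characteristic is positive. -/
structure Admissible [Fintype D] [Fintype V] [Fintype F] : Prop where
  five_le_deg : ∀ x, 5 ≤ M.deg x
  phi_ne : ∀ x, M.phi x ≠ x
  phi_phi_ne : ∀ x, M.phi (M.phi x) ≠ x
  euler : Fintype.card D < 2 * Fintype.card V + 2 * Fintype.card F

/-! ### Adding a chord -/

section AddChord

variable (x : D)

/-- The dart of the chord that is called `inr true` starts in the tail of `M.phi (M.phi x)`; it is
inserted after `cornerLeft x` in the rotation. -/
def cornerLeft : D := M.flip (M.phi x)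

/-- The dart of the chord that is called `inr false` starts in the tail of `x`; it is inserted after
`cornerRight x` in the rotation. -/
def cornerRight : D := M.next⁻¹ x

theorem next_cornerRight : M.next (M.cornerRight x) = x := M.next.apply_symm_apply x

theorem next_cornerLeft : M.next (M.cornerLeft x) = M.phi (M.phi x) := rfl

variable {x}

theorem cornerLeft_ne_cornerRight (h2 : M.phi (M.phi x) ≠ x) :
    M.cornerLeft x ≠ M.cornerRight x := fun h => by
  apply h2
  rw [← M.next_cornerLeft, h, M.next_cornerRight]

theorem flip_eq_cornerLeft {y : D} : M.flip y = M.cornerLeft x ↔ y = M.phi x :=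
  M.flip.injective.eq_iff

theorem flip_eq_cornerRight {y : D} : M.flip y = M.cornerRight x ↔ M.phi y = x := by
  unfold phi
  rw [← M.next.injective.eq_iff, next_cornerRight]

variable [DecidableEq D] (x)

/-- The rotation after the chord has been added. -/
def chordNext : Equiv.Perm (D ⊕ Bool) :=
  Equiv.sumCongr M.next (Equiv.refl Bool) *
    (Equiv.swap (Sum.inl (M.cornerLeft x)) (Sum.inr true) *
      Equiv.swap (Sum.inl (M.cornerRight x)) (Sum.inr false))

variable {x}

theorem chordNext_cornerLeft (h2 : M.phi (M.phi x) ≠ x) :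
    M.chordNext x (Sum.inl (M.cornerLeft x)) = Sum.inr true := by
  have := M.cornerLeft_ne_cornerRight h2
  simp [chordNext, Equiv.swap_apply_of_ne_of_ne, this]

theorem chordNext_cornerRight : M.chordNext x (Sum.inl (M.cornerRight x)) = Sum.inr false := by
  simp [chordNext, Equiv.swap_apply_of_ne_of_ne]

theorem chordNext_true : M.chordNext x (Sum.inr true) = Sum.inl (M.phi (M.phi x)) := by
  simp [chordNext, Equiv.swap_apply_of_ne_of_ne, next_cornerLeft]

theorem chordNext_false (h2 : M.phi (M.phi x) ≠ x) : M.chordNext x (Sum.inr false) = Sum.inl x := by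
  have := M.cornerLeft_ne_cornerRight h2
  simp [chordNext, Equiv.swap_apply_of_ne_of_ne, next_cornerRight, this.symm]

theorem chordNext_of_ne {y : D} (hl : y ≠ M.cornerLeft x) (hr : y ≠ M.cornerRight x) :
    M.chordNext x (Sum.inl y) = Sum.inl (M.next y) := by
  simp [chordNext, Equiv.swap_apply_of_ne_of_ne, hl, hr]

/-- The tails of the darts after the chord has been added. -/
def chordVert (x : D) : D ⊕ Bool → V
  | Sum.inl y => M.vert y
  | Sum.inr true => M.vert (M.cornerLeft x)
  | Sum.inr false => M.vert (M.cornerRight x)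

/-- The faces after the chord has been added: the new face `none` is a triangle that consists of
`x`, `M.phi x` and the dart `inr true`. -/
def chordFace (x : D) : D ⊕ Bool → Option F
  | Sum.inl y => if y = x ∨ y = M.phi x then none else some (M.face y)
  | Sum.inr true => none
  | Sum.inr false => some (M.face x)

theorem chordVert_chordNext (h2 : M.phi (M.phi x) ≠ x) (z : D ⊕ Bool) :
    M.chordVert x (M.chordNext x z) = M.chordVert x z := by
  rcases z with y | b
  · by_cases hl : y = M.cornerLeft x
    · rw [hl, M.chordNext_cornerLeft h2]; rfl
    by_cases hr : y = M.cornerRight x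
    · rw [hr, M.chordNext_cornerRight]; rfl
    rw [M.chordNext_of_ne hl hr]
    exact M.vert_next y
  · cases b
    · rw [M.chordNext_false h2]
      change M.vert x = M.vert _
      rw [← M.vert_next (M.cornerRight x), next_cornerRight]
    · rw [M.chordNext_true]
      change M.vert _ = M.vert _
      rw [← M.vert_next (M.cornerLeft x), next_cornerLeft]

theorem sameCycle_chordNext_next (h2 : M.phi (M.phi x) ≠ x) (y : D) :
    (M.chordNext x).SameCycle (Sum.inl y) (Sum.inl (M.next y)) := by
  by_cases hl : y = M.cornerLeft x
  · refine ⟨2, ?_⟩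
    rw [hl, zpow_ofNat, pow_two, Equiv.Perm.mul_apply, M.chordNext_cornerLeft h2,
      M.chordNext_true, next_cornerLeft]
  by_cases hr : y = M.cornerRight x
  · refine ⟨2, ?_⟩
    rw [hr, zpow_ofNat, pow_two, Equiv.Perm.mul_apply, M.chordNext_cornerRight,
      M.chordNext_false h2, next_cornerRight]
  exact ⟨1, by rw [zpow_one, M.chordNext_of_ne hl hr]⟩

theorem exists_sameCycle_inl (h2 : M.phi (M.phi x) ≠ x) (z : D ⊕ Bool) :
    ∃ y, (M.chordNext x).SameCycle z (Sum.inl y) := by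
  rcases z with y | b
  · exact ⟨y, Equiv.Perm.SameCycle.refl _ _⟩
  · cases b
    · exact ⟨x, 1, by rw [zpow_one, M.chordNext_false h2]⟩
    · exact ⟨_, 1, by rw [zpow_one, M.chordNext_true]⟩

theorem chordVert_eq_of_sameCycle (h2 : M.phi (M.phi x) ≠ x) {z z' : D ⊕ Bool}
    (h : (M.chordNext x).SameCycle z z') :
    M.chordVert x z = M.chordVert x z' := by
  obtain ⟨n, rfl⟩ := h
  induction n with
  | zero => rfl
  | succ n ih =>
    rw [add_comm, zpow_add, zpow_one, Equiv.Perm.mul_apply, M.chordVert_chordNext h2, ih]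
  | pred n ih =>
    rw [ih, ← M.chordVert_chordNext h2 ((M.chordNext x ^ (-(n : ℤ) - 1)) z),
      ← Equiv.Perm.mul_apply, ← zpow_one_add, add_sub_cancel]

theorem chordVert_eq_iff (h2 : M.phi (M.phi x) ≠ x) [Finite D] (z z' : D ⊕ Bool) :
    M.chordVert x z = M.chordVert x z' ↔ (M.chordNext x).SameCycle z z' := by
  refine ⟨fun h => ?_, M.chordVert_eq_of_sameCycle h2⟩
  obtain ⟨y, hy⟩ := M.exists_sameCycle_inl h2 z
  obtain ⟨y', hy'⟩ := M.exists_sameCycle_inl h2 z'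
  rw [M.chordVert_eq_of_sameCycle h2 hy, M.chordVert_eq_of_sameCycle h2 hy'] at h
  obtain ⟨n, rfl⟩ := ((M.vert_eq_iff y y').1 h).exists_nat_pow_eq
  refine hy.trans (Equiv.Perm.SameCycle.trans ?_ hy'.symm)
  clear hy hy' h
  induction n with
  | zero => exact Equiv.Perm.SameCycle.refl _ _
  | succ n ih =>
    rw [add_comm, pow_add, pow_one, Equiv.Perm.mul_apply]
    exact ih.trans (M.sameCycle_chordNext_next h2 _)

/-- The reversal of darts after the chord has been added. -/
def chordFlip : Equiv.Perm (D ⊕ Bool) := Equiv.sumCongr M.flip Equiv.boolNot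

theorem chordPhi_inl (h2 : M.phi (M.phi x) ≠ x) (y : D) :
    M.chordNext x (M.chordFlip (Sum.inl y)) =
      if y = M.phi x then Sum.inr true else if M.phi y = x then Sum.inr false
      else Sum.inl (M.phi y) := by
  change M.chordNext x (Sum.inl (M.flip y)) = _
  split_ifs with hl hr
  · rw [M.flip_eq_cornerLeft.2 hl, M.chordNext_cornerLeft h2]
  · rw [M.flip_eq_cornerRight.2 hr, M.chordNext_cornerRight]
  · exact M.chordNext_of_ne (mt M.flip_eq_cornerLeft.1 hl) (mt M.flip_eq_cornerRight.1 hr)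

theorem chordPhi_true (h2 : M.phi (M.phi x) ≠ x) :
    M.chordNext x (M.chordFlip (Sum.inr true)) = Sum.inl x :=
  M.chordNext_false h2

theorem chordPhi_false :
    M.chordNext x (M.chordFlip (Sum.inr false)) = Sum.inl (M.phi (M.phi x)) :=
  M.chordNext_true

theorem chordFace_chordPhi (h2 : M.phi (M.phi x) ≠ x) (h1 : ∀ y, M.phi y ≠ y) (z : D ⊕ Bool) :
    M.chordFace x (M.chordNext x (M.chordFlip z)) = M.chordFace x z := by
  rcases z with y | _ | _
  · rw [M.chordPhi_inl h2]
    split_ifs with hl hr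
    · simp [chordFace, hl]
    · have hyx : y ≠ x := fun h => h1 x (by rw [h] at hr; exact hr)
      simp [chordFace, hl, hyx, ← M.face_phi y, hr]
    · simp [chordFace, hl, hr, M.phi_injective.eq_iff, M.face_phi]
  · rw [M.chordPhi_false]
    simp [chordFace, h2, h1 (M.phi x), M.face_phi]
  · rw [M.chordPhi_true h2]
    simp [chordFace]

/-- Cut a face along a chord that cuts off the triangle between `x` and `M.phi x`. -/
def addChord [Finite D] (h2 : M.phi (M.phi x) ≠ x) (h1 : ∀ y, M.phi y ≠ y) :
    CombMap (D ⊕ Bool) V (Option F) where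
  flip := M.chordFlip
  next := M.chordNext x
  flip_flip := by rintro (y | _ | _) <;> simp [chordFlip, M.flip_flip]
  vert := M.chordVert x
  vert_eq_iff := M.chordVert_eq_iff h2
  vert_surjective v := by
    obtain ⟨y, rfl⟩ := M.vert_surjective v
    exact ⟨Sum.inl y, rfl⟩
  face := M.chordFace x
  face_next_flip := M.chordFace_chordPhi h2 h1
  face_surjective f := by
    rcases f with _ | f
    · exact ⟨Sum.inr true, rfl⟩
    obtain ⟨y, rfl⟩ := M.face_surjective f
    by_cases hy : y = x ∨ y = M.phi x
    · refine ⟨Sum.inr false, ?_⟩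
      rcases hy with rfl | rfl <;> simp [chordFace, M.face_phi]
    · exact ⟨Sum.inl y, by simp [chordFace, hy]⟩

variable [Finite D] (h2 : M.phi (M.phi x) ≠ x) (h1 : ∀ y, M.phi y ≠ y)

theorem deg_le_addChord (y : D) : M.deg y ≤ (M.addChord h2 h1).deg (Sum.inl y) :=
  Nat.card_le_card_of_injective
    (fun z : {z // M.vert z = M.vert y} => (⟨Sum.inl z.1, z.2⟩ :
      {z // (M.addChord h2 h1).vert z = (M.addChord h2 h1).vert (Sum.inl y)}))
    fun _ _ h => Subtype.ext (Sum.inl_injective (congrArg Subtype.val h))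

theorem deg_lt_addChord {y : D} (b : Bool)
    (h : (M.addChord h2 h1).vert (Sum.inr b) = M.vert y) :
    M.deg y < (M.addChord h2 h1).deg (Sum.inl y) := by
  have := Fintype.ofFinite {z // M.vert z = M.vert y}
  have key : Nat.card (Option {z // M.vert z = M.vert y}) ≤
      (M.addChord h2 h1).deg (Sum.inl y) := by
    refine Nat.card_le_card_of_injective
      (fun z => z.elim (⟨Sum.inr b, h⟩ :
        {z // (M.addChord h2 h1).vert z = (M.addChord h2 h1).vert (Sum.inl y)})
        fun z => ⟨Sum.inl z.1, z.2⟩) ?_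
    rintro (_ | a) (_ | c) hac
    · rfl
    · exact absurd (congrArg Subtype.val hac) (by simp)
    · exact absurd (congrArg Subtype.val hac) (by simp)
    · exact congrArg some (Subtype.ext (Sum.inl_injective (congrArg Subtype.val hac)))
  rw [Nat.card_eq_fintype_card, Fintype.card_option] at key
  unfold deg at key ⊢
  rw [Nat.card_eq_fintype_card]
  omega

theorem exists_vert_eq_inl (b : Bool) :
    ∃ y, (M.addChord h2 h1).vert (Sum.inr b) = M.vert y := by
  cases b <;> exact ⟨_, rfl⟩

/-- A vertex of degree five of the new map had at least this degree before, so it is not an end of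
the chord; and its neighbours had at most their new degrees before. -/
theorem HasStar.of_addChord {κ : Fin 5 → ℕ∞} (h5 : ∀ y, 5 ≤ M.deg y)
    (h : (M.addChord h2 h1).HasStar κ) : M.HasStar κ := by
  obtain ⟨z, hz, hstar⟩ := h
  have hne : ∀ y b, (M.addChord h2 h1).deg (Sum.inl y) = 5 →
      (M.addChord h2 h1).vert (Sum.inr b) ≠ M.vert y := fun y b hy hv => by
    have := M.deg_lt_addChord h2 h1 b hv
    have := h5 y
    omega
  obtain ⟨y, rfl⟩ : ∃ y, z = Sum.inl y := by
    rcases z with y | b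
    · exact ⟨y, rfl⟩
    · obtain ⟨y, hy⟩ := M.exists_vert_eq_inl h2 h1 b
      refine absurd hy (hne y b ?_)
      rw [← hz]
      exact (M.addChord h2 h1).deg_congr hy.symm
  have hnext : ∀ w, M.vert w = M.vert y → (M.addChord h2 h1).next (Sum.inl w) =
      Sum.inl (M.next w) := fun w hw => by
    refine M.chordNext_of_ne ?_ ?_
    · rintro rfl
      exact hne y true hz hw
    · rintro rfl
      exact hne y false hz hw
  have hpow : ∀ n : ℕ, ((M.addChord h2 h1).next ^ n) (Sum.inl y) = Sum.inl ((M.next ^ n) y) := by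
    intro n
    induction n with
    | zero => rfl
    | succ n ih =>
      rw [pow_succ', Equiv.Perm.mul_apply, ih, hnext _ (M.vert_next_pow n y), pow_succ',
        Equiv.Perm.mul_apply]
  have hinv : ∀ n : ℕ, M.vert ((M.next⁻¹ ^ n) y) = M.vert y ∧
      ((M.addChord h2 h1).next⁻¹ ^ n) (Sum.inl y) = Sum.inl ((M.next⁻¹ ^ n) y) := by
    intro n
    induction n with
    | zero => exact ⟨rfl, rfl⟩
    | succ n ih =>
      rw [pow_succ' M.next⁻¹, Equiv.Perm.mul_apply, M.vert_next_symm,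
        pow_succ' (M.addChord h2 h1).next⁻¹, Equiv.Perm.mul_apply, ih.2]
      refine ⟨ih.1, ?_⟩
      rw [Equiv.Perm.inv_eq_iff_eq, hnext _ ((M.vert_next_symm _).trans ih.1)]
      exact congrArg _ (M.next.apply_symm_apply _).symm
  have hhead : ∀ w, (M.headDeg w : ℕ∞) ≤ (M.addChord h2 h1).headDeg (Sum.inl w) := fun w =>
    Nat.cast_le.2 (M.deg_le_addChord h2 h1 (M.flip w))
  refine ⟨y, le_antisymm (hz ▸ M.deg_le_addChord h2 h1 y) (h5 y), hstar.imp ?_ ?_⟩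
  · exact fun h i => (hhead _).trans (hpow i ▸ h i)
  · exact fun h i => (hhead _).trans ((hinv i).2 ▸ h i)

end AddChord

theorem Admissible.addChord [Fintype D] [Fintype V] [Fintype F] [DecidableEq D] {M : CombMap D V F}
    (hM : M.Admissible) {x : D} (h3 : M.phi (M.phi (M.phi x)) ≠ x) :
    (M.addChord (hM.phi_phi_ne x) hM.phi_ne).Admissible where
  five_le_deg z := by
    rcases z with y | b
    · exact (hM.five_le_deg y).trans (M.deg_le_addChord _ _ y)
    · obtain ⟨y, hy⟩ := M.exists_vert_eq_inl (hM.phi_phi_ne x) hM.phi_ne b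
      refine ((hM.five_le_deg y).trans
        (M.deg_le_addChord (hM.phi_phi_ne x) hM.phi_ne y)).trans_eq ?_
      exact (CombMap.deg_congr _ hy).symm
  phi_ne z := by
    change M.chordNext x (M.chordFlip z) ≠ z
    rcases z with y | _ | _
    · rw [M.chordPhi_inl (hM.phi_phi_ne x)]
      split_ifs <;> simp [hM.phi_ne]
    · rw [M.chordPhi_false]
      simp
    · rw [M.chordPhi_true (hM.phi_phi_ne x)]
      simp
  phi_phi_ne z := by
    change M.chordNext x (M.chordFlip (M.chordNext x (M.chordFlip z))) ≠ z
    have h2 := hM.phi_phi_ne x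
    have h1 := hM.phi_ne
    rcases z with y | _ | _
    · rw [M.chordPhi_inl h2]
      split_ifs with hl hr
      · rw [M.chordPhi_true h2, hl]
        simpa using (h1 x).symm
      · rw [M.chordPhi_false, Ne, Sum.inl.injEq]
        rintro rfl
        exact h3 hr
      · rw [M.chordPhi_inl h2]
        split_ifs <;> simp [hM.phi_phi_ne]
    · rw [M.chordPhi_false, M.chordPhi_inl h2]
      simp [h1 (M.phi x), h3]
    · rw [M.chordPhi_true h2, M.chordPhi_inl h2]
      simp [h1 x, (h1 x).symm]
  euler := by
    have := hM.euler
    simp only [Fintype.card_sum, Fintype.card_bool, Fintype.card_option]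
    omega

/-- There are at least three darts for each face. -/
theorem Admissible.three_mul_card_face_le [Fintype D] [Fintype V] [Fintype F] {M : CombMap D V F}
    (hM : M.Admissible) : 3 * Fintype.card F ≤ Fintype.card D := by
  choose g hg using M.face_surjective
  let walk : F × Fin 3 → D := fun p => M.phi^[p.2] (g p.1)
  have hface : ∀ p, M.face (walk p) = p.1 := by
    rintro ⟨f, i⟩
    fin_cases i <;> simp [walk, M.face_phi, hg]
  have hinj : Function.Injective walk := by
    rintro ⟨f, i⟩ ⟨f', j⟩ h
    obtain rfl : f = f' := (hface (f, i)).symm.trans ((congrArg M.face h).trans (hface _))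
    have h1 := hM.phi_ne (g f)
    have h2 := hM.phi_phi_ne (g f)
    have h3 := hM.phi_ne (M.phi (g f))
    fin_cases i <;> fin_cases j <;> first
      | rfl
      | exact absurd h h1
      | exact absurd h h2
      | exact absurd h h3
      | exact absurd h.symm h1
      | exact absurd h.symm h2
      | exact absurd h.symm h3
  have := Fintype.card_le_of_injective walk hinj
  simpa [mul_comm] using this

universe u

/-- Every admissible map can be triangulated by chords without creating new stars. -/
theorem exists_hasStar_of_triangulated {V : Type*} [Fintype V] {S : List (Fin 5 → ℕ∞)}
    (H : ∀ {D F : Type u} [Fintype D] [Fintype F] (M : CombMap D V F), M.Admissible →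
      (∀ x, M.phi (M.phi (M.phi x)) = x) → ∃ κ ∈ S, M.HasStar κ)
    {D F : Type u} [Fintype D] [Fintype F] (M : CombMap D V F) (hM : M.Admissible) :
    ∃ κ ∈ S, M.HasStar κ := by
  induction hn : Fintype.card D - 3 * Fintype.card F using Nat.strong_induction_on
    generalizing D F with
  | _ n ih =>
    classical
    by_cases h : ∀ x, M.phi (M.phi (M.phi x)) = x
    · exact H M hM h
    push Not at h
    obtain ⟨x, hx⟩ := h
    have hM' := hM.addChord hx
    have hlt := hM'.three_mul_card_face_le
    obtain ⟨κ, hκ, hs⟩ := ih _ (by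
      simp only [Fintype.card_sum, Fintype.card_bool, Fintype.card_option] at hlt ⊢
      omega) _ hM' rfl
    exact ⟨κ, hκ, HasStar.of_addChord M _ _ hM.five_le_deg hs⟩

end CombMap

/-! ### Finite bookkeeping of the discharging rules -/

namespace Discharging

/-- Degrees are only remembered up to the class of degrees that behave alike: the classes are
`5, …, 15`, `{16, 17}`, `{18, …, 35}` and `{36, 37, …}`, each named by its least element. -/
def degreeClass (d : ℕ) : ℕ :=
  if d ≤ 15 then d else if d ≤ 17 then 16 else if d ≤ 35 then 18 else 36

def degreeClasses : List ℕ := [5, 6, 7, 8, 9, 10, 11, 12, 13, 14, 15, 16, 18, 36]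

theorem degreeClass_mem {d : ℕ} (hd : 5 ≤ d) : degreeClass d ∈ degreeClasses := by
  unfold degreeClass degreeClasses
  split_ifs
  · interval_cases d <;> simp
  all_goals simp

theorem degreeClass_eq_five {d : ℕ} : degreeClass d = 5 ↔ d = 5 := by
  unfold degreeClass
  split_ifs <;> omega

/-- What a vertex of degree `d` can afford for each incident edge, which is `(d - 6) / d`, in units
of `1 / 120` and rounded down so that it depends on the class of the degree only.  The classes `7`,
`11` and `13` have rules of their own and do not use it. -/
def share (w : ℕ) : ℕ :=
  if w = 8 then 30 else if w = 9 then 40 else if w = 10 then 48 else if w = 12 then 60 else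
  if w = 14 then 68 else if w = 15 then 72 else if w = 16 then 75 else if w = 18 then 80 else
  if w = 36 then 100 else 0

theorem share_mul_le {d : ℕ} (hd : 5 ≤ d) : (share (degreeClass d) : ℤ) * d + 720 ≤ 120 * d ∨
    d = 5 := by
  unfold degreeClass
  split_ifs with h1 h2 h3
  · interval_cases d <;> simp [share]
  all_goals
    left
    simp [share]
    omega

/-- How many of the two given degrees are not `5`. -/
def numBig (x y : ℕ) : ℕ := (if x = 5 then 0 else 1) + (if y = 5 then 0 else 1)

/-- What a vertex of degree `7` sends to a neighbour of degree `5`; see `gift`. A `7`-vertex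
surrounded by `5`-vertices cannot afford `20` for each of them, but it need not: the amount is `20`
only if one of `p` and `q` is `5` and the other one is `36`, and `5` and `36` cannot alternate
around an odd cycle. -/
def gift7 (x p q y : ℕ) : ℕ :=
  if x = 5 ∧ y = 5 then
    if min p q = 5 then if max p q = 36 then 20 else 0
    else if max p q = 36 then 0 else 17
  else if x = 5 ∨ y = 5 then 20 else 40

/-- The case `x = y = 5` of `gift11`. -/
def gift11Inner (p q : ℕ) : ℕ :=
  if min p q = 5 then if 11 ≤ max p q then 60 else 0
  else if 8 ≤ min p q then if min p q = 8 then 30 else 0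
  else if max p q ≤ 8 then 0 else if max p q = 10 then 48 else 60

/-- What a vertex of degree `11` sends to a neighbour of degree `5`; see `gift`. -/
def gift11 (x p q y : ℕ) : ℕ :=
  if x = 5 then if y = 5 then gift11Inner p q else if p = 10 then 72 else 60
  else if y = 5 then if q = 10 then 72 else 60
  else 100

/-- The case `x = y = 5` of `gift13`. -/
def gift13Inner (p q : ℕ) : ℕ :=
  if min p q = 5 then if max p q = 10 then 67 else if 11 ≤ max p q then 65 else 0
  else if min p q = 6 then if 9 ≤ max p q then 60 else 0
  else if min p q = 7 then if 8 ≤ max p q then 55 else 0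
  else 30

/-- The case of `gift13` in which one of `x` and `y` is `5`, and `p` is the degree of the
neighbour next to that one. -/
def gift13End (p : ℕ) : ℕ :=
  if p = 5 then 85 else if p = 6 then 80 else if p = 7 then 83 else if p = 8 then 90 else
  if p = 9 then 80 else if p = 10 then 72 else 64

/-- What a vertex of degree `13` sends to a neighbour of degree `5`; see `gift`. -/
def gift13 (x p q y : ℕ) : ℕ :=
  if x = 5 then if y = 5 then gift13Inner p q else gift13End p
  else if y = 5 then gift13End q
  else 120

/-- The charge, in units of `1 / 120`, that a vertex of degree class `w` sends to a neighbour `u` of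
degree `5`, if the neighbours of `u` have the degree classes `w, x, p, q, y` in this cyclic order.
In general each edge at the sender carries `share w`, and what it would carry to a neighbour of
degree at least `6` goes half and half to the next neighbours on both sides, as far as these have
degree `5`. -/
def gift (w x p q y : ℕ) : ℕ :=
  if w = 7 then gift7 x p q y else if w = 11 then gift11 x p q y
  else if w = 13 then gift13 x p q y else share w * (2 + numBig x y) / 2

/-- One half of `transfer`: the neighbours of the sender have the degree classes `5, b, z, n, B` in
this cyclic order, where the `5` is the receiver. -/
def transferTo (B b z n : ℕ) : ℕ :=
  if b = 5 then
    (if 13 ≤ B ∧ 13 ≤ z then if 18 ≤ B ∧ 18 ≤ z then 10 else 5 else 0) +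
    (if n = 5 then 0 else if B = 8 then 10 else if B = 10 then 5 else 0)
  else 0

/-- The charge that a vertex of degree `5` sends to a neighbour of degree `5`, if its other
neighbours have the degree classes `a, b, c, d`, in cyclic order from the receiver. -/
def transfer (a b c d : ℕ) : ℕ := transferTo d a b c + transferTo a d c b

/-- What a vertex of degree `5` with neighbours of degree classes `a, b, c, d, e` receives from
neighbours of larger degree. -/
def inflow (a b c d e : ℕ) : ℕ :=
  gift a b c d e + gift b c d e a + gift c d e a b + gift d e a b c + gift e a b c d

/-- What a vertex of degree `5` with neighbours of degree classes `a, b, c, d, e` sends to the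
first of them. -/
def outTerm (a b c d e : ℕ) : ℕ := if a = 5 then transfer b c d e else 0

/-- What a vertex of degree `5` with neighbours of degree classes `a, b, c, d, e` sends. -/
def outflow (a b c d e : ℕ) : ℕ :=
  outTerm a b c d e + outTerm b c d e a + outTerm c d e a b + outTerm d e a b c + outTerm e a b c d

/-- The upper bounds of `starTypes`, with `36` in place of `⊤`: no degree class exceeds `36`. -/
def starBounds : List (List ℕ) :=
  [[5, 7, 7, 5, 17], [5, 7, 8, 5, 11], [5, 7, 5, 8, 8], [8, 5, 5, 11, 6], [8, 5, 5, 8, 7],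
   [8, 5, 5, 7, 8], [8, 5, 5, 6, 9], [5, 6, 5, 8, 11], [5, 6, 6, 5, 36], [5, 6, 6, 6, 17],
   [6, 6, 6, 6, 11], [6, 6, 6, 7, 8], [6, 6, 7, 6, 8], [5, 6, 6, 11, 7], [5, 6, 11, 6, 7],
   [5, 6, 6, 8, 8], [5, 6, 8, 6, 8], [5, 7, 6, 8, 7], [5, 6, 7, 7, 7], [5, 6, 6, 7, 11],
   [5, 6, 7, 6, 11], [5, 7, 6, 7, 8], [5, 7, 7, 6, 8], [5, 7, 6, 6, 14], [5, 8, 6, 6, 11],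
   [5, 5, 7, 6, 14], [5, 6, 7, 5, 35], [5, 6, 8, 5, 15], [5, 6, 9, 5, 10], [5, 6, 11, 5, 9],
   [5, 5, 10, 5, 12], [5, 7, 11, 5, 8], [5, 6, 5, 7, 14], [5, 5, 9, 5, 17]]

/-- Termwise comparison of two lists of the same length. -/
def fits : List ℕ → List ℕ → Bool
  | a :: l, b :: m => Nat.ble a b && fits l m
  | _, _ => true

/-- Some star type bounds the degree classes `a, b, c, d, e` in one of their ten cyclic
arrangements. -/
def dominated (a b c d e : ℕ) : Bool :=
  [[a, b, c, d, e], [b, c, d, e, a], [c, d, e, a, b], [d, e, a, b, c], [e, a, b, c, d],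
   [e, d, c, b, a], [d, c, b, a, e], [c, b, a, e, d], [b, a, e, d, c], [a, e, d, c, b]].any
    fun l => starBounds.any (fits l)

/-! ### The neighbourhood of a vertex of degree five -/

/-- A lower bound for `gift` that only depends on the two degrees next to the sender. -/
def lowGift (w x y : ℕ) : ℕ :=
  if w = 7 then 20 * numBig x y
  else if w = 11 then if x = 5 ∧ y = 5 then 0 else 60
  else if w = 13 then if x = 5 ∧ y = 5 then 0 else 64
  else share w * (2 + numBig x y) / 2

theorem lowGift_le (w x p q y : ℕ) : lowGift w x y ≤ gift w x p q y := by
  unfold lowGift gift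
  split_ifs with h1 h2 h3 h4 h5
  all_goals first | exact le_rfl | exact Nat.zero_le _ | skip
  · unfold gift7 numBig; split_ifs <;> simp_all
  · unfold gift11; split_ifs <;> simp_all
  · unfold gift13 gift13End; split_ifs <;> simp_all

theorem transferTo_le (B b z n : ℕ) : transferTo B b z n ≤ 10 := by
  unfold transferTo; split_ifs <;> omega

theorem transferTo_of_ne {b : ℕ} (B z n : ℕ) (h : b ≠ 5) : transferTo B b z n = 0 := by
  simp [transferTo, h]

theorem transferTo_five_left (b z n : ℕ) : transferTo 5 b z n = 0 := by
  simp [transferTo]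

theorem transferTo_five_five (B b : ℕ) : transferTo B b 5 5 = 0 := by
  simp [transferTo]

theorem outflow_le (a b c d e : ℕ) : outflow a b c d e ≤ 20 := by
  have key := transferTo_le
  unfold outflow outTerm transfer
  by_cases ha : a = 5 <;> by_cases hb : b = 5 <;> by_cases hc : c = 5 <;> by_cases hd : d = 5 <;>
    by_cases he : e = 5 <;>
    simp only [ha, hb, hc, hd, he, if_true, if_false, transferTo_five_left, transferTo_five_five,
      transferTo_of_ne, ne_eq, not_false_eq_true, add_zero, zero_add] <;>
    first
    | omega
    | exact (key _ _ _ _).trans (by norm_num)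
    | exact add_le_add (key _ _ _ _) (key _ _ _ _)

def enough (a b c d e : ℕ) : Bool :=
  Nat.ble (outflow a b c d e + 120) (inflow a b c d e)

/-- The neighbourhoods whose inflow does not suffice, from a neighbour of largest degree on. -/
def isScarce (a b c d e : ℕ) : Bool :=
  [[18, 5, 8, 5, 5], [13, 5, 10, 5, 5], [14, 5, 10, 5, 5],
   [18, 5, 5, 8, 5], [13, 5, 5, 10, 5], [14, 5, 5, 10, 5]].contains [a, b, c, d, e]

/-- Every neighbourhood with largest degree class `a` is dominated, scarce, or has enough inflow.
The first two tests cut off the search as soon as one or two gifts suffice; here `140 = 120 + 20`,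
and `20` is the bound of `outflow_le`. -/
def checkFrom (a : ℕ) : Bool :=
  let l := degreeClasses.filter (fun b => Nat.ble b a)
  l.all fun b => l.all fun e => Nat.ble 140 (lowGift a b e) ||
    l.all fun c => Nat.ble 140 (lowGift a b e + lowGift b c a) ||
      l.all fun d => enough a b c d e || dominated a b c d e || isScarce a b c d e

set_option maxRecDepth 100000 in
theorem checkFrom_eq_true : degreeClasses.all checkFrom = true := by decide +kernel

theorem inflow_sufficient {a b c d e : ℕ} (ha : a ∈ degreeClasses) (hb : b ∈ degreeClasses)
    (hc : c ∈ degreeClasses) (hd : d ∈ degreeClasses) (he : e ∈ degreeClasses)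
    (hba : b ≤ a) (hca : c ≤ a) (hda : d ≤ a) (hea : e ≤ a) (h : dominated a b c d e = false) :
    outflow a b c d e + 120 ≤ inflow a b c d e ∨ isScarce a b c d e = true := by
  have key := List.all_eq_true.1 checkFrom_eq_true a ha
  simp only [checkFrom, List.all_eq_true, List.mem_filter, Nat.ble_eq, Bool.or_eq_true,
    enough] at key
  have hout := outflow_le a b c d e
  have h1 := lowGift_le a b c d e
  have h2 := lowGift_le b c d e a
  rcases key b ⟨hb, hba⟩ e ⟨he, hea⟩ with h3 | h3
  · left; unfold inflow; omega
  rcases h3 c ⟨hc, hca⟩ with h3 | h3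
  · left; unfold inflow; omega
  simpa [h] using h3 d ⟨hd, hda⟩

/-! ### The neighbours of a vertex of degree 7, 11 or 13 -/

/-- The gifts of vertices of degree `7`, `11` and `13` only depend on these coarser classes of the
degrees `p` and `q`. -/
def coarseClass (d : ℕ) : ℕ := if d ≤ 11 then d else if d = 36 then 36 else 11

def coarseClasses : List ℕ := [5, 6, 7, 8, 9, 10, 11, 36]

theorem coarseClass_mem {d : ℕ} (h : d ∈ degreeClasses) : coarseClass d ∈ coarseClasses := by
  revert d
  decide

theorem five_le_of_mem {d : ℕ} (h : d ∈ coarseClasses) : 5 ≤ d := by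
  simp only [coarseClasses, List.mem_cons, List.not_mem_nil, or_false] at h
  omega

theorem gift_coarseClass {w : ℕ} (hw : w ∈ [7, 11, 13]) (x y : ℕ) {p q : ℕ}
    (hp : p ∈ degreeClasses) (hq : q ∈ degreeClasses) :
    gift w x (coarseClass p) (coarseClass q) y = gift w x p q y := by
  have key : ∀ w ∈ [7, 11, 13], ∀ x ∈ [5, 6], ∀ y ∈ [5, 6], ∀ p ∈ degreeClasses,
      ∀ q ∈ degreeClasses, gift w x (coarseClass p) (coarseClass q) y = gift w x p q y := by
    decide +kernel
  have hxy : ∀ p q, gift w x p q y =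
      gift w (if x = 5 then 5 else 6) p q (if y = 5 then 5 else 6) := fun p q => by
    simp only [List.mem_cons, List.not_mem_nil, or_false] at hw
    rcases hw with rfl | rfl | rfl <;> by_cases hx : x = 5 <;> by_cases hy : y = 5 <;>
      simp [gift, gift7, gift11, gift13, hx, hy]
  rw [hxy, hxy p q]
  exact key w hw _ (by split_ifs <;> simp) _ (by split_ifs <;> simp) p hp q hq

/-- The states of a walk around a vertex: `0` if the present neighbour does not have degree `5`, `1`
if it has and the preceding one has not, and otherwise the degree class of the second common
neighbour of the two. -/
def ringStates : List ℕ := 0 :: 1 :: coarseClasses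

/-- What the present neighbour receives from a vertex of degree `w`, if the state changes from `s`
to `t`; `none` if this change is impossible. -/
def stepGain (w s t : ℕ) : Option ℕ :=
  if s = 0 then if t ≤ 1 then some 0 else none
  else if t = 1 then none
  else if s = 1 then some (if t = 0 then gift w 6 5 5 6 else gift w 6 5 t 5)
  else some (if t = 0 then gift w 5 s 5 6 else gift w 5 s t 5)

def extendGain (w s t x : ℕ) : ℕ :=
  match stepGain w s t with
  | none => 0
  | some g => g + x

/-- For each state, `1000` more than the largest gain of a walk of `n` steps from this state to the
state `target`.  (A value below `1000` is meaningless: there is no such walk.) -/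
def bestWalk (w target : ℕ) : ℕ → List (ℕ × ℕ)
  | 0 => ringStates.map fun s => (s, if s = target then 1000 else 0)
  | n + 1 => ringStates.map fun s =>
      (s, ((bestWalk w target n).map fun p => extendGain w s p.1 p.2).foldr max 0)

/-- A closed walk of `w` steps gains at most the charge `w - 6`. -/
def checkRing (w target : ℕ) : Bool :=
  (bestWalk w target w).all fun p => p.1 != target || Nat.ble p.2 (1000 + 120 * (w - 6))

set_option maxRecDepth 100000 in
theorem checkRing_eq_true : [7, 11, 13].all (fun w => ringStates.all (checkRing w)) = true := by
  decide +kernel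

/-- The state of the neighbour with index `i + 1`, if `H` lists the degree classes of the neighbours
and `Y (i + 1)` is that of the second common neighbour of the neighbours `i` and `i + 1`. -/
def ringState (H Y : ℕ → ℕ) (i : ℕ) : ℕ :=
  if H (i + 1) ≠ 5 then 0 else if H i ≠ 5 then 1 else Y (i + 1)

/-- What the neighbour with index `i + 1` receives. -/
def ringGift (w : ℕ) (H Y : ℕ → ℕ) (i : ℕ) : ℕ :=
  if H (i + 1) = 5 then gift w (H i) (Y (i + 1)) (Y (i + 2)) (H (i + 2)) else 0

theorem stepGain_ringState {w : ℕ} (hw : w ∈ [7, 11, 13]) {H Y : ℕ → ℕ} (i : ℕ)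
    (hY : ∀ i, Y i ∈ coarseClasses) :
    stepGain w (ringState H Y i) (ringState H Y (i + 1)) = some (ringGift w H Y i) := by
  have h1 := five_le_of_mem (hY (i + 1))
  have h2 := five_le_of_mem (hY (i + 2))
  have n1 : Y (i + 1) ≠ 0 := by omega
  have n2 : Y (i + 1) ≠ 1 := by omega
  have n3 : Y (i + 2) ≠ 0 := by omega
  have n4 : Y (i + 2) ≠ 1 := by omega
  simp only [List.mem_cons, List.not_mem_nil, or_false] at hw
  unfold stepGain ringState ringGift
  rcases hw with rfl | rfl | rfl <;>
    by_cases a : H i = 5 <;> by_cases b : H (i + 1) = 5 <;> by_cases c : H (i + 2) = 5 <;>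
    simp [a, b, c, n1, n2, n3, n4, gift, gift7, gift11, gift13]

theorem exists_bestWalk {w : ℕ} (hw : w ∈ [7, 11, 13]) {H Y : ℕ → ℕ}
    (hY : ∀ i, Y i ∈ coarseClasses) (n i : ℕ) :
    ∃ x, (ringState H Y i, x) ∈ bestWalk w (ringState H Y (i + n)) n ∧
      1000 + ∑ j ∈ Finset.range n, ringGift w H Y (i + j) ≤ x := by
  have hmem : ∀ i, ringState H Y i ∈ ringStates := fun i => by
    have := hY (i + 1)
    unfold ringState ringStates
    split_ifs <;> simp [this]
  induction n generalizing i with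
  | zero => exact ⟨1000, by simpa [bestWalk] using hmem i, by simp⟩
  | succ n ih =>
    obtain ⟨x, hx, hle⟩ := ih (i + 1)
    rw [show i + 1 + n = i + (n + 1) by ring] at hx
    refine ⟨_, List.mem_map.2 ⟨_, hmem i, rfl⟩, ?_⟩
    have hle' : ringGift w H Y i + x ≤ ((bestWalk w (ringState H Y (i + (n + 1))) n).map
        fun p => extendGain w (ringState H Y i) p.1 p.2).foldr max 0 := by
      refine List.le_max_of_le' 0 (List.mem_map.2 ⟨_, hx, rfl⟩) ?_
      simp [extendGain, stepGain_ringState hw i hY]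
    refine le_trans ?_ hle'
    have hsum : ∑ j ∈ Finset.range n, ringGift w H Y (i + (j + 1)) =
        ∑ j ∈ Finset.range n, ringGift w H Y (i + 1 + j) :=
      Finset.sum_congr rfl fun j _ => by rw [show i + (j + 1) = i + 1 + j by ring]
    rw [Finset.sum_range_succ', hsum, add_zero]
    omega

/-- A vertex of degree `7`, `11` or `13` does not send more than its charge. -/
theorem sum_ringGift_le_special {w : ℕ} (hw : w ∈ [7, 11, 13]) {H Y : ℕ → ℕ}
    (hY : ∀ i, Y i ∈ degreeClasses) (hHw : ∀ i, H (i + w) = H i) (hYw : ∀ i, Y (i + w) = Y i) :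
    ∑ j ∈ Finset.range w, ringGift w H Y j ≤ 120 * (w - 6) := by
  let Z : ℕ → ℕ := fun i => coarseClass (Y i)
  have hZ : ∀ i, Z i ∈ coarseClasses := fun i => coarseClass_mem (hY i)
  have hYZ : ∀ j, ringGift w H Y j = ringGift w H Z j := fun j => by
    simp only [ringGift, Z, gift_coarseClass hw _ _ (hY (j + 1)) (hY (j + 2))]
  simp only [hYZ]
  obtain ⟨x, hx, hle⟩ := exists_bestWalk hw (H := H) hZ w 0
  have hs : ringState H Z (0 + w) = ringState H Z 0 := by
    simp only [ringState, Z]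
    rw [show 0 + w + 1 = 0 + 1 + w by ring, hHw, hHw, hYw]
  rw [hs] at hx
  have hmem : ringState H Z 0 ∈ ringStates := by
    have := hZ (0 + 1)
    unfold ringState ringStates
    split_ifs <;> simp [this]
  have h1 := List.all_eq_true.1 (List.all_eq_true.1 checkRing_eq_true w hw) _ hmem
  have h2 := List.all_eq_true.1 h1 _ hx
  simp only [bne_self_eq_false, Bool.false_or, Nat.ble_eq] at h2
  simp only [zero_add] at hle
  omega

/-- The general rule: the shares that are redirected from neighbours of larger degree are counted at
these neighbours, so that each neighbour accounts for at most `share w`. -/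
theorem sum_ringGift_le_share {w d : ℕ} (h7 : w ≠ 7) (h11 : w ≠ 11) (h13 : w ≠ 13) {H Y : ℕ → ℕ}
    (hH : ∀ i, H (i + d) = H i) :
    ∑ j ∈ Finset.range d, ringGift w H Y j ≤ share w * d := by
  have shift : ∀ f : ℕ → ℕ, (∀ i, f (i + d) = f i) →
      ∑ j ∈ Finset.range d, f (j + 1) = ∑ j ∈ Finset.range d, f j := fun f hf => by
    have h1 := Finset.sum_range_succ f d
    have h2 := Finset.sum_range_succ' f d
    have h3 := hf 0
    rw [zero_add] at h3
    omega
  -- twice the amounts: `A i` is redirected from neighbour `i` to neighbour `i + 1`, `B i` from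
  -- neighbour `i + 1` to neighbour `i`, and `C i` is what neighbour `i` gets from its own edge
  let A : ℕ → ℕ := fun i => if H i ≠ 5 ∧ H (i + 1) = 5 then share w else 0
  let B : ℕ → ℕ := fun i => if H (i + 1) ≠ 5 ∧ H i = 5 then share w else 0
  let C : ℕ → ℕ := fun i => if H i = 5 then 2 * share w else 0
  have hA : ∀ i, A (i + d) = A i := fun i => by
    simp only [A, hH, show i + d + 1 = i + 1 + d by ring]
  have hB : ∀ i, B (i + d) = B i := fun i => by
    simp only [B, hH, show i + d + 1 = i + 1 + d by ring]
  have hle : ∀ i, 2 * ringGift w H Y i ≤ C (i + 1) + A i + B (i + 1) := fun i => by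
    have hdiv : ∀ n, 2 * (share w * n / 2) ≤ share w * n := fun n => Nat.mul_div_le _ _
    simp only [ringGift, gift, h7, h11, h13, if_false, A, B, C, add_assoc]
    by_cases b : H (i + 1) = 5
    · rw [if_pos b]
      refine (hdiv _).trans ?_
      unfold numBig
      by_cases a : H i = 5 <;> by_cases c : H (i + (1 + 1)) = 5 <;>
        simp [a, b, c] <;> omega
    · simp [b]
  have hle2 : ∀ i, C (i + 1) + A (i + 1) + B i ≤ 2 * share w := fun i => by
    simp only [A, B, C]
    by_cases b : H (i + 1) = 5 <;> by_cases a : H i = 5 <;> by_cases c : H (i + 1 + 1) = 5 <;>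
      simp [a, b, c] <;> omega
  have s1 := Finset.sum_le_sum fun i (_ : i ∈ Finset.range d) => hle i
  have s2 := Finset.sum_le_sum fun i (_ : i ∈ Finset.range d) => hle2 i
  simp only [Finset.sum_add_distrib, ← Finset.mul_sum] at s1 s2
  rw [shift A hA] at s2
  rw [shift B hB] at s1
  simp only [Finset.sum_const, Finset.card_range, smul_eq_mul] at s2
  nlinarith

/-- No vertex of degree at least `6` sends more than its charge. -/
theorem sum_ringGift_le {d : ℕ} (hd : 6 ≤ d) {H Y : ℕ → ℕ} (hY : ∀ i, Y i ∈ degreeClasses)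
    (hHd : ∀ i, H (i + d) = H i) (hYd : ∀ i, Y (i + d) = Y i) :
    ∑ j ∈ Finset.range d, ringGift (degreeClass d) H Y j + 720 ≤ 120 * d := by
  by_cases h : d ∈ [7, 11, 13]
  · have key := sum_ringGift_le_special h hY hHd hYd
    have : degreeClass d = d := by
      simp only [List.mem_cons, List.not_mem_nil, or_false] at h
      unfold degreeClass
      rw [if_pos (by omega)]
    rw [this]
    omega
  · simp only [List.mem_cons, List.not_mem_nil, or_false, not_or] at h
    have hne : ∀ k, d ≠ k → k ≤ 13 → degreeClass d ≠ k := fun k h1 h2 => by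
      unfold degreeClass
      split_ifs <;> omega
    have key := sum_ringGift_le_share (hne 7 h.1 (by norm_num)) (hne 11 h.2.1 (by norm_num))
      (hne 13 h.2.2 (by norm_num)) (Y := Y) hHd
    rcases share_mul_le (show 5 ≤ d by omega) with h1 | h1
    · zify at key ⊢
      linarith
    · omega

end Discharging

/-! ### Star types and scarce neighbourhoods -/

namespace Discharging

theorem le_of_degreeClass_le {d : ℕ} (k : ℕ)
    (hk : k ∈ [5, 6, 7, 8, 9, 10, 11, 12, 14, 15, 17, 35])
    (h : degreeClass d ≤ k) : (d : ℕ∞) ≤ k := by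
  refine Nat.cast_le.2 ?_
  unfold degreeClass at h
  simp only [List.mem_cons, List.not_mem_nil, or_false] at hk
  split_ifs at h <;> omega

/-- The lists of bounds on degree classes are at least as strict as the star types. -/
theorem forall₂_starBounds : List.Forall₂ (fun m κ => ∀ a b c d e : ℕ,
    fits [degreeClass a, degreeClass b, degreeClass c, degreeClass d, degreeClass e] m = true →
      ∀ i : Fin 5, ((![a, b, c, d, e] i : ℕ) : ℕ∞) ≤ κ i) starBounds starTypes := by
  unfold starBounds starTypes
  repeat' first | exact List.Forall₂.nil | apply List.Forall₂.cons
  all_goals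
    intro a b c d e h
    simp only [fits, Bool.and_eq_true, Nat.ble_eq, and_true] at h
    obtain ⟨h1, h2, h3, h4, h5⟩ := h
    intro i
    fin_cases i
    all_goals first
      | exact le_top
      | exact le_of_degreeClass_le _ (by decide) h1
      | exact le_of_degreeClass_le _ (by decide) h2
      | exact le_of_degreeClass_le _ (by decide) h3
      | exact le_of_degreeClass_le _ (by decide) h4
      | exact le_of_degreeClass_le _ (by decide) h5

theorem exists_starType {a b c d e : ℕ} (h : starBounds.any (fits [degreeClass a, degreeClass b,
    degreeClass c, degreeClass d, degreeClass e]) = true) :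
    ∃ κ ∈ starTypes, ∀ i : Fin 5, ((![a, b, c, d, e] i : ℕ) : ℕ∞) ≤ κ i := by
  obtain ⟨m, hm, hfits⟩ := List.any_eq_true.1 h
  obtain ⟨n, hn, rfl⟩ := List.getElem_of_mem hm
  have hlen := forall₂_starBounds.length_eq
  exact ⟨starTypes[n], List.getElem_mem _,
    (List.forall₂_iff_get.1 forall₂_starBounds).2 n hn (hlen ▸ hn) a b c d e hfits⟩

/-- The finite part of the argument for scarce neighbourhoods.  In the neighbourhood
`B, 5, A, 5, 5`, the two adjacent `5`-vertices have another common neighbour, of degree class `z`,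
and the one next to `A` has a last neighbour, of degree class `m`. -/
theorem scarce_relief : ∀ p ∈ [(18, 8), (13, 10), (14, 10)], ∀ m ∈ degreeClasses,
    ∀ z ∈ degreeClasses, outflow p.1 5 p.2 5 5 + 120 ≤
        inflow p.1 5 p.2 5 5 + (transfer p.2 m z 5 + transferTo p.1 5 z 5) ∨
      dominated 5 p.2 m z 5 = true := by
  decide +kernel

theorem scarce_relief_mirror : ∀ p ∈ [(18, 8), (13, 10), (14, 10)], ∀ m ∈ degreeClasses,
    ∀ z ∈ degreeClasses, outflow p.1 5 5 p.2 5 + 120 ≤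
        inflow p.1 5 5 p.2 5 + (transfer 5 z m p.2 + transferTo p.1 5 z 5) ∨
      dominated 5 5 z m p.2 = true := by
  decide +kernel

theorem transferTo_five_le (B b z n : ℕ) : transferTo B b z 5 ≤ transferTo B b z n := by
  unfold transferTo
  split_ifs <;> omega

theorem gift_five (x p q y : ℕ) : gift 5 x p q y = 0 := by simp [gift, share]

end Discharging

/-! ### Discharging in a triangulated map -/

namespace CombMap

open Discharging

variable {D V F : Type*} (M : CombMap D V F)

theorem injOn_next_pow (x : D) :
    Set.InjOn (fun i => (M.next ^ i) x) (Finset.range (Function.minimalPeriod M.next x)) := by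
  intro i hi j hj h
  simp only [Equiv.Perm.coe_pow] at h
  exact Function.iterate_injOn_Iio_minimalPeriod (by simpa using hi) (by simpa using hj) h

theorem filter_vert_eq [Fintype D] [DecidableEq D] [DecidableEq V] (x : D) :
    (Finset.univ.filter fun y => M.vert y = M.vert x) =
      (Finset.range (Function.minimalPeriod M.next x)).image fun i => (M.next ^ i) x := by
  obtain ⟨n, hn, hnx⟩ := isOfFinOrder_iff_pow_eq_one.1 (isOfFinOrder_of_finite M.next)
  have hpos : 0 < Function.minimalPeriod M.next x :=
    Function.minimalPeriod_pos_of_mem_periodicPts ⟨n, hn, by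
      rw [Function.IsPeriodicPt, Function.IsFixedPt, ← Equiv.Perm.coe_pow, hnx]; rfl⟩
  ext y
  simp only [Finset.mem_filter, Finset.mem_univ, true_and, Finset.mem_image, Finset.mem_range]
  constructor
  · intro h
    obtain ⟨i, rfl⟩ := ((M.vert_eq_iff x y).1 h.symm).exists_nat_pow_eq
    refine ⟨i % Function.minimalPeriod M.next x, Nat.mod_lt _ hpos, ?_⟩
    rw [Equiv.Perm.coe_pow, Equiv.Perm.coe_pow, Function.iterate_mod_minimalPeriod_eq]
  · rintro ⟨i, -, rfl⟩
    exact M.vert_next_pow i x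

theorem deg_eq_minimalPeriod [Finite D] (x : D) :
    M.deg x = Function.minimalPeriod M.next x := by
  classical
  have := Fintype.ofFinite D
  rw [deg, Nat.card_eq_fintype_card, Fintype.card_subtype, M.filter_vert_eq,
    Finset.card_image_of_injOn (M.injOn_next_pow x), Finset.card_range]

theorem next_pow_deg [Finite D] (x : D) : (M.next ^ M.deg x) x = x := by
  rw [deg_eq_minimalPeriod, Equiv.Perm.coe_pow, Function.iterate_minimalPeriod]

theorem sum_vert_eq [Fintype D] [DecidableEq V] {R : Type*} [AddCommMonoid R] (f : D → R) (x : D) :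
    ∑ y with M.vert y = M.vert x, f y = ∑ i ∈ Finset.range (M.deg x), f ((M.next ^ i) x) := by
  classical
  rw [filter_vert_eq, Finset.sum_image (M.injOn_next_pow x), deg_eq_minimalPeriod]

/-- The degree class of the `i`-th neighbour of the tail of `x`, counted from the head of `x`. -/
noncomputable def nbr (x : D) (i : ℕ) : ℕ := degreeClass (M.headDeg ((M.next ^ i) x))

theorem nbr_next_pow (x : D) (k i : ℕ) : M.nbr ((M.next ^ k) x) i = M.nbr x (i + k) := by
  unfold nbr
  rw [pow_add, Equiv.Perm.mul_apply]

theorem nbr_add_deg [Finite D] (x : D) (i : ℕ) : M.nbr x (i + M.deg x) = M.nbr x i := by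
  unfold nbr
  rw [pow_add, Equiv.Perm.mul_apply, next_pow_deg]

theorem nbr_zero (x : D) : M.nbr x 0 = degreeClass (M.headDeg x) := rfl

theorem nbr_flip_zero (x : D) : M.nbr (M.flip x) 0 = degreeClass (M.deg x) := by
  rw [nbr_zero, headDeg, flip_flip]

variable {M}

theorem Admissible.nbr_mem [Fintype D] [Fintype V] [Fintype F] (hM : M.Admissible) (x : D) (i : ℕ) :
    M.nbr x i ∈ degreeClasses :=
  degreeClass_mem (hM.five_le_deg _)

/-! ### Stars around a vertex of degree five -/

theorem exists_hasStar_of_dominated [Finite D] {x : D} (hx : M.deg x = 5)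
    (h : dominated (M.nbr x 0) (M.nbr x 1) (M.nbr x 2) (M.nbr x 3) (M.nbr x 4) = true) :
    ∃ κ ∈ starTypes, M.HasStar κ := by
  have hper : ∀ i, (M.next ^ (i + 5)) x = (M.next ^ i) x := fun i => by
    rw [pow_add, Equiv.Perm.mul_apply, ← hx, next_pow_deg]
  have hdeg : ∀ k, M.deg ((M.next ^ k) x) = 5 := fun k =>
    (M.deg_congr (M.vert_next_pow k x)).trans hx
  have hinv : ∀ i k, (M.next⁻¹ ^ i) ((M.next ^ (k + i)) x) = (M.next ^ k) x := fun i k => by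
    rw [add_comm k i, pow_add, Equiv.Perm.mul_apply, ← Equiv.Perm.mul_apply, inv_pow,
      inv_mul_cancel, Equiv.Perm.one_apply]
  have forward : ∀ k, starBounds.any (fits [M.nbr x k, M.nbr x (k + 1), M.nbr x (k + 2),
      M.nbr x (k + 3), M.nbr x (k + 4)]) = true → ∃ κ ∈ starTypes, M.HasStar κ := fun k hk => by
    obtain ⟨κ, hκ, hle⟩ := exists_starType hk
    refine ⟨κ, hκ, (M.next ^ k) x, hdeg k, Or.inl fun i => ?_⟩
    rw [← Equiv.Perm.mul_apply, ← pow_add, add_comm]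
    convert hle i using 2
    fin_cases i <;> rfl
  have backward : ∀ k, starBounds.any (fits [M.nbr x (k + 4), M.nbr x (k + 3), M.nbr x (k + 2),
      M.nbr x (k + 1), M.nbr x k]) = true → ∃ κ ∈ starTypes, M.HasStar κ := fun k hk => by
    obtain ⟨κ, hκ, hle⟩ := exists_starType hk
    refine ⟨κ, hκ, (M.next ^ (k + 4)) x, hdeg _, Or.inr fun i => ?_⟩
    convert hle i using 2
    fin_cases i
    · rfl
    · exact congrArg M.headDeg (hinv 1 (k + 3))
    · exact congrArg M.headDeg (hinv 2 (k + 2))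
    · exact congrArg M.headDeg (hinv 3 (k + 1))
    · exact congrArg M.headDeg (hinv 4 k)
  have hn : ∀ i, M.nbr x (i + 5) = M.nbr x i := fun i => by rw [nbr, hper, nbr]
  have h5 := hn 0
  have h6 := hn 1
  have h7 := hn 2
  have h8 := hn 3
  norm_num at h5 h6 h7 h8
  simp only [dominated, List.any_cons, List.any_nil, Bool.or_false, Bool.or_eq_true] at h
  rcases h with h | h | h | h | h | h | h | h | h | h
  · exact forward 0 h
  · exact forward 1 (by simpa [h5] using h)
  · exact forward 2 (by simpa [h5, h6] using h)
  · exact forward 3 (by simpa [h5, h6, h7] using h)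
  · exact forward 4 (by simpa [h5, h6, h7, h8] using h)
  · exact backward 0 h
  · exact backward 4 (by simpa [h5, h6, h7, h8] using h)
  · exact backward 3 (by simpa [h5, h6, h7] using h)
  · exact backward 2 (by simpa [h5, h6] using h)
  · exact backward 1 (by simpa [h5] using h)

/-! ### Triangles -/

/-- If `y` leads from `w` to `u`, and `s` is the dart that precedes the dart from `u` to `w` around
`u`, then `s` and `M.next y` both lead to the third vertex of a triangle with side `y`. -/
theorem headDeg_of_next_eq_flip (hT : ∀ x, M.phi (M.phi (M.phi x)) = x) {s y : D}
    (h : M.next s = M.flip y) : M.headDeg s = M.headDeg (M.next y) := by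
  have h1 : M.phi (M.flip s) = M.flip y := by rw [phi, M.flip_flip, h]
  have h2 := hT (M.flip s)
  rw [h1, phi, phi, M.flip_flip] at h2
  unfold headDeg
  rw [← h2]
  exact M.deg_congr (M.vert_next _)

theorem flip_next_flip_next (hT : ∀ x, M.phi (M.phi (M.phi x)) = x) (y : D) :
    M.next (M.flip (M.next (M.flip (M.next y)))) = M.flip y := by
  have h2 := hT (M.flip y)
  simpa only [phi, M.flip_flip] using h2

theorem nbr_flip_next_one (hT : ∀ x, M.phi (M.phi (M.phi x)) = x) (y : D) :
    M.nbr (M.flip (M.next y)) 1 = M.nbr y 0 := by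
  refine congrArg degreeClass ?_
  change M.deg _ = M.deg (M.flip y)
  conv_rhs => rw [← flip_next_flip_next hT y]
  exact (M.deg_congr (M.vert_next _)).symm

theorem nbr_flip_four [Finite D] (hT : ∀ x, M.phi (M.phi (M.phi x)) = x) {y : D}
    (hy : M.headDeg y = 5) : M.nbr (M.flip y) 4 = M.nbr y 1 := by
  refine congrArg degreeClass (headDeg_of_next_eq_flip hT ?_)
  have h := M.next_pow_deg (M.flip y)
  rw [show M.deg (M.flip y) = 4 + 1 from hy, pow_succ', Equiv.Perm.mul_apply] at h
  exact h

theorem nbr_flip_three [Finite D] (hT : ∀ x, M.phi (M.phi (M.phi x)) = x) {y : D}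
    (hy : M.headDeg y = 5) : M.nbr (M.flip y) 3 = M.nbr (M.flip (M.next y)) 2 := by
  refine congrArg degreeClass (headDeg_of_next_eq_flip hT ?_)
  have h := M.next_pow_deg (M.flip y)
  rw [show M.deg (M.flip y) = 3 + 1 + 1 from hy, pow_succ', Equiv.Perm.mul_apply, pow_succ',
    Equiv.Perm.mul_apply] at h
  exact M.next.injective (h.trans (flip_next_flip_next hT y).symm)

/-! ### The discharging rules -/

variable (M)

/-- The charge that is sent along a dart, from its tail to its head. -/
noncomputable def sent (x : D) : ℕ :=
  if M.deg x = 5 then outTerm (M.nbr x 0) (M.nbr x 1) (M.nbr x 2) (M.nbr x 3) (M.nbr x 4)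
  else if M.headDeg x = 5 then
    gift (degreeClass (M.deg x)) (M.nbr (M.flip x) 1) (M.nbr (M.flip x) 2) (M.nbr (M.flip x) 3)
      (M.nbr (M.flip x) 4)
  else 0

variable {M}

/-- A vertex of degree at least six does not send more than its charge. -/
theorem sum_sent_le [Fintype D] [Fintype V] [Fintype F] (hM : M.Admissible)
    (hT : ∀ x, M.phi (M.phi (M.phi x)) = x) {x : D} (hx : M.deg x ≠ 5) :
    ∑ i ∈ Finset.range (M.deg x), M.sent ((M.next ^ i) (M.next x)) + 720 ≤ 120 * M.deg x := by
  have h6 : 6 ≤ M.deg x := by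
    have := hM.five_le_deg x
    omega
  let Y : ℕ → ℕ := fun i => M.nbr (M.flip ((M.next ^ i) x)) 2
  have hY : ∀ i, Y (i + M.deg x) = Y i := fun i => by
    simp only [Y]
    rw [pow_add, Equiv.Perm.mul_apply, next_pow_deg]
  refine le_of_eq_of_le (congrArg (· + 720) (Finset.sum_congr rfl fun i _ => ?_))
    (sum_ringGift_le h6 (H := M.nbr x) (Y := Y) (fun i => hM.nbr_mem _ _) (M.nbr_add_deg x) hY)
  have hnext : ∀ i, (M.next ^ (i + 1)) x = M.next ((M.next ^ i) x) := fun i => by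
    rw [pow_succ', Equiv.Perm.mul_apply]
  have e : (M.next ^ i) (M.next x) = M.next ((M.next ^ i) x) := by
    rw [← hnext, pow_succ, Equiv.Perm.mul_apply]
  have hdeg : M.deg (M.next ((M.next ^ i) x)) = M.deg x :=
    M.deg_congr ((M.vert_next _).trans (M.vert_next_pow i x))
  have h1 : M.nbr x (i + 1) = 5 ↔ M.headDeg (M.next ((M.next ^ i) x)) = 5 := by
    rw [nbr, degreeClass_eq_five, hnext]
  rw [e, sent, hdeg, if_neg hx, ringGift]
  by_cases h : M.headDeg (M.next ((M.next ^ i) x)) = 5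
  · rw [if_pos h, if_pos (h1.2 h), nbr_flip_next_one hT, nbr_flip_three hT h, nbr_flip_four hT h]
    congr 1
    · simp only [Y, hnext]
    · simp only [Y, hnext]
    · rw [← hnext, nbr_next_pow, add_left_comm]
  · rw [if_neg h, if_neg (mt h1.1 h)]

theorem gift_le_sent_flip {x : D} (hx : M.deg x = 5) :
    gift (M.nbr x 0) (M.nbr x 1) (M.nbr x 2) (M.nbr x 3) (M.nbr x 4) ≤ M.sent (M.flip x) := by
  by_cases h : M.headDeg x = 5
  · rw [nbr_zero, h]
    exact (gift_five _ _ _ _).trans_le (Nat.zero_le _)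
  · have h' : M.deg (M.flip x) ≠ 5 := h
    rw [sent, if_neg h', headDeg, M.flip_flip, if_pos hx]
    exact le_rfl

theorem sent_flip_of_headDeg {x : D} (hx : M.deg x = 5) (h : M.headDeg x = 5) :
    M.sent (M.flip x) = transfer (M.nbr (M.flip x) 1) (M.nbr (M.flip x) 2) (M.nbr (M.flip x) 3)
      (M.nbr (M.flip x) 4) := by
  have h' : M.deg (M.flip x) = 5 := h
  rw [sent, if_pos h', outTerm, nbr_flip_zero, if_pos (degreeClass_eq_five.2 hx)]

theorem nbr_next_pow_of_deg [Finite D] {x : D} (hx : M.deg x = 5) (i j : ℕ) :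
    M.nbr ((M.next ^ i) x) j = M.nbr x ((j + i) % 5) := by
  rw [nbr_next_pow]
  conv_lhs => rw [← Nat.mod_add_div (j + i) 5]
  generalize (j + i) / 5 = k
  induction k with
  | zero => rfl
  | succ k ih => rw [mul_add, mul_one, ← add_assoc, ← hx, nbr_add_deg, hx, ih]

theorem sum_sent_of_five [Finite D] {x : D} (hx : M.deg x = 5) :
    ∑ i ∈ Finset.range 5, M.sent ((M.next ^ i) x) =
      outflow (M.nbr x 0) (M.nbr x 1) (M.nbr x 2) (M.nbr x 3) (M.nbr x 4) := by
  have h : ∀ i, M.deg ((M.next ^ i) x) = 5 := fun i => (M.deg_congr (M.vert_next_pow i x)).trans hx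
  simp only [Finset.sum_range_succ, Finset.sum_range_zero, zero_add, sent, h, if_true,
    nbr_next_pow_of_deg hx]
  rfl

theorem gift_next_pow_le [Finite D] {x : D} (hx : M.deg x = 5) (i : ℕ) :
    gift (M.nbr x (i % 5)) (M.nbr x ((1 + i) % 5)) (M.nbr x ((2 + i) % 5)) (M.nbr x ((3 + i) % 5))
      (M.nbr x ((4 + i) % 5)) ≤ M.sent (M.flip ((M.next ^ i) x)) := by
  have h := gift_le_sent_flip ((M.deg_congr (M.vert_next_pow i x)).trans hx)
  simpa only [nbr_next_pow_of_deg hx, zero_add] using h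

theorem inflow_le [Finite D] {x : D} (hx : M.deg x = 5) :
    inflow (M.nbr x 0) (M.nbr x 1) (M.nbr x 2) (M.nbr x 3) (M.nbr x 4) ≤
      ∑ i ∈ Finset.range 5, M.sent (M.flip ((M.next ^ i) x)) := by
  simp only [Finset.sum_range_succ, Finset.sum_range_zero, zero_add]
  exact add_le_add (add_le_add (add_le_add (add_le_add (gift_next_pow_le hx 0)
    (gift_next_pow_le hx 1)) (gift_next_pow_le hx 2)) (gift_next_pow_le hx 3))
    (gift_next_pow_le hx 4)

/-- What two neighbours of degree five send to a `5`-vertex comes on top of `inflow`, which only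
counts gifts of neighbours of larger degree. -/
theorem inflow_add_transfer_le [Finite D] {x : D} (hx : M.deg x = 5) {i j : ℕ} (hij : i ≠ j)
    (hi5 : i < 5) (hj5 : j < 5) (hi : M.nbr x i = 5) (hj : M.nbr x j = 5) :
    inflow (M.nbr x 0) (M.nbr x 1) (M.nbr x 2) (M.nbr x 3) (M.nbr x 4) +
      (M.sent (M.flip ((M.next ^ i) x)) + M.sent (M.flip ((M.next ^ j) x))) ≤
      ∑ i ∈ Finset.range 5, M.sent (M.flip ((M.next ^ i) x)) := by
  have h := gift_next_pow_le hx
  have h0 := h 0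
  have h1 := h 1
  have h2 := h 2
  have h3 := h 3
  have h4 := h 4
  norm_num at h0 h1 h2 h3 h4
  simp only [Finset.sum_range_succ, Finset.sum_range_zero, zero_add, inflow]
  interval_cases i <;> interval_cases j <;>
    first
    | exact absurd rfl hij
    | (simp only [hi, hj, gift_five] at h0 h1 h2 h3 h4 ⊢
       simp only [pow_zero, pow_one, Equiv.Perm.one_apply] at h0 h1 h2 h3 h4 ⊢
       omega)

theorem exists_max_nbr [Finite D] {x : D} (hx : M.deg x = 5) :
    ∃ y, M.vert y = M.vert x ∧ ∀ i, M.nbr y i ≤ M.nbr y 0 := by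
  obtain ⟨k, hk5, hk⟩ := Finset.exists_max_image (Finset.range 5) (M.nbr x) ⟨0, by simp⟩
  refine ⟨(M.next ^ k) x, M.vert_next_pow k x, fun i => ?_⟩
  rw [nbr_next_pow_of_deg hx, nbr_next_pow_of_deg hx, zero_add,
    Nat.mod_eq_of_lt (Finset.mem_range.1 hk5)]
  exact hk _ (Finset.mem_range.2 (Nat.mod_lt _ (by norm_num)))

section Five

variable [Fintype D] [Fintype V] [Fintype F]

/-- The two adjacent `5`-neighbours in a scarce neighbourhood make up for the missing charge. -/
theorem scarce_inflow (hM : M.Admissible) (hT : ∀ x, M.phi (M.phi (M.phi x)) = x)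
    (hdom : ∀ x, M.deg x = 5 →
      dominated (M.nbr x 0) (M.nbr x 1) (M.nbr x 2) (M.nbr x 3) (M.nbr x 4) = false)
    {x : D} (hx : M.deg x = 5)
    (h : isScarce (M.nbr x 0) (M.nbr x 1) (M.nbr x 2) (M.nbr x 3) (M.nbr x 4) = true) :
    outflow (M.nbr x 0) (M.nbr x 1) (M.nbr x 2) (M.nbr x 3) (M.nbr x 4) + 120 ≤
      ∑ i ∈ Finset.range 5, M.sent (M.flip ((M.next ^ i) x)) := by
  have hdeg : ∀ i, M.deg ((M.next ^ i) x) = 5 := fun i =>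
    (M.deg_congr (M.vert_next_pow i x)).trans hx
  have hnext : ∀ i, (M.next ^ (i + 1)) x = M.next ((M.next ^ i) x) := fun i => by
    rw [pow_succ', Equiv.Perm.mul_apply]
  have h1 : ∀ i, M.nbr (M.flip ((M.next ^ (i + 1)) x)) 1 = M.nbr x (i % 5) := fun i => by
    rw [hnext, nbr_flip_next_one hT, nbr_next_pow_of_deg hx, zero_add]
  have hfive : ∀ i, M.nbr x i = 5 → M.headDeg ((M.next ^ i) x) = 5 := fun i hi =>
    degreeClass_eq_five.1 hi
  have h3 : ∀ i, M.nbr x i = 5 → M.nbr (M.flip ((M.next ^ i) x)) 3 =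
      M.nbr (M.flip ((M.next ^ (i + 1)) x)) 2 := fun i hi => by
    rw [hnext, nbr_flip_three hT (hfive i hi)]
  have h4 : ∀ i, M.nbr x i = 5 → M.nbr (M.flip ((M.next ^ i) x)) 4 = M.nbr x ((1 + i) % 5) :=
    fun i hi => by rw [nbr_flip_four hT (hfive i hi), nbr_next_pow_of_deg hx]
  have h0 : ∀ i, M.nbr (M.flip ((M.next ^ i) x)) 0 = 5 := fun i => by
    rw [nbr_flip_zero, hdeg]; rfl
  have hsent : ∀ i, M.nbr x i = 5 → M.sent (M.flip ((M.next ^ i) x)) =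
      transfer (M.nbr (M.flip ((M.next ^ i) x)) 1) (M.nbr (M.flip ((M.next ^ i) x)) 2)
        (M.nbr (M.flip ((M.next ^ i) x)) 3) (M.nbr (M.flip ((M.next ^ i) x)) 4) := fun i hi =>
    sent_flip_of_headDeg (hdeg i) (hfive i hi)
  simp only [isScarce, List.contains_eq_mem, List.mem_cons, List.cons.injEq, and_true,
    List.not_mem_nil, or_false, decide_eq_true_eq] at h
  have hcases : ∃ p ∈ [(18, 8), (13, 10), (14, 10)], M.nbr x 0 = p.1 ∧ M.nbr x 1 = 5 ∧
      M.nbr x 4 = 5 ∧ (M.nbr x 2 = p.2 ∧ M.nbr x 3 = 5 ∨ M.nbr x 2 = 5 ∧ M.nbr x 3 = p.2) := by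
    rcases h with h | h | h | h | h | h <;> simp [h]
  obtain ⟨p, hp, e0, e1, e4, ⟨e2, e3⟩ | ⟨e2, e3⟩⟩ := hcases
  · have key := inflow_add_transfer_le hx (i := 3) (j := 4) (by norm_num) (by norm_num)
      (by norm_num) e3 e4
    have hd := hdom (M.flip ((M.next ^ 3) x)) (hfive 3 e3)
    rw [hsent 3 e3, hsent 4 e4, h1 2, h1 3, h4 3 e3, h4 4 e4, ← h3 3 e3] at key
    rw [h0, h1 2, h4 3 e3] at hd
    norm_num at key hd
    rw [e2, e4] at hd
    rw [e0, e1, e2, e3, e4] at key ⊢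
    have hrel := (scarce_relief p hp _ (hM.nbr_mem _ 2) _ (hM.nbr_mem _ 3)).resolve_right
      (by rw [hd]; exact Bool.false_ne_true)
    have hle := transferTo_five_le p.1 5 (M.nbr (M.flip ((M.next ^ 3) x)) 3)
      (M.nbr (M.flip ((M.next ^ 4) x)) 3)
    have hle' : transferTo p.1 5 (M.nbr (M.flip ((M.next ^ 3) x)) 3)
      (M.nbr (M.flip ((M.next ^ 4) x)) 3) ≤ transfer 5 (M.nbr (M.flip ((M.next ^ 3) x)) 3)
      (M.nbr (M.flip ((M.next ^ 4) x)) 3) p.1 := Nat.le_add_right _ _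
    omega
  · have key := inflow_add_transfer_le hx (i := 1) (j := 2) (by norm_num) (by norm_num)
      (by norm_num) e1 e2
    have hd := hdom (M.flip ((M.next ^ 2) x)) (hfive 2 e2)
    rw [hsent 1 e1, hsent 2 e2, h1 0, h1 1, h4 1 e1, h4 2 e2, h3 1 e1] at key
    rw [h0, h1 1, h4 2 e2] at hd
    norm_num at key hd
    rw [e1, e3] at hd
    rw [e0, e1, e2, e3, e4] at key ⊢
    have hrel := (scarce_relief_mirror p hp _ (hM.nbr_mem _ 3) _ (hM.nbr_mem _ 2)).resolve_right
      (by rw [hd]; exact Bool.false_ne_true)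
    have hle := transferTo_five_le p.1 5 (M.nbr (M.flip ((M.next ^ 2) x)) 2)
      (M.nbr (M.flip ((M.next ^ 1) x)) 2)
    have hle' : transferTo p.1 5 (M.nbr (M.flip ((M.next ^ 2) x)) 2)
      (M.nbr (M.flip ((M.next ^ 1) x)) 2) ≤ transfer p.1 (M.nbr (M.flip ((M.next ^ 1) x)) 2)
      (M.nbr (M.flip ((M.next ^ 2) x)) 2) 5 := Nat.le_add_left _ _
    simp only [pow_one] at hle hle'
    omega

/-- A vertex of degree five receives `120` more than it sends. -/
theorem outflow_add_le (hM : M.Admissible) (hT : ∀ x, M.phi (M.phi (M.phi x)) = x)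
    (hdom : ∀ x, M.deg x = 5 →
      dominated (M.nbr x 0) (M.nbr x 1) (M.nbr x 2) (M.nbr x 3) (M.nbr x 4) = false)
    {x : D} (hx : M.deg x = 5) (hmax : ∀ i, M.nbr x i ≤ M.nbr x 0) :
    ∑ i ∈ Finset.range 5, M.sent ((M.next ^ i) x) + 120 ≤
      ∑ i ∈ Finset.range 5, M.sent (M.flip ((M.next ^ i) x)) := by
  rw [sum_sent_of_five hx]
  rcases inflow_sufficient (hM.nbr_mem x 0) (hM.nbr_mem x 1) (hM.nbr_mem x 2) (hM.nbr_mem x 3)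
    (hM.nbr_mem x 4) (hmax 1) (hmax 2) (hmax 3) (hmax 4) (hdom x hx) with h | h
  · exact h.trans (inflow_le hx)
  · exact scarce_inflow hM hT hdom hx h

theorem exists_hasStar_of_triangulation (hM : M.Admissible)
    (hT : ∀ x, M.phi (M.phi (M.phi x)) = x) : ∃ κ ∈ starTypes, M.HasStar κ := by
  classical
  by_contra hno
  have hdom : ∀ x, M.deg x = 5 →
      dominated (M.nbr x 0) (M.nbr x 1) (M.nbr x 2) (M.nbr x 3) (M.nbr x 4) = false := by
    intro x hx
    by_contra h
    exact hno (exists_hasStar_of_dominated hx (Bool.not_eq_false _ ▸ h))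
  -- the final charge of a vertex of degree `d` is the sum of this over its darts, minus `720`
  let g : D → ℤ := fun x => 120 - M.sent x + M.sent (M.flip x)
  have hvert : ∀ v : V, 720 ≤ ∑ x with M.vert x = v, g x := fun v => by
    obtain ⟨x, rfl⟩ := M.vert_surjective v
    by_cases hx : M.deg x = 5
    · obtain ⟨y, hy, hmax⟩ := exists_max_nbr hx
      have hy5 : M.deg y = 5 := (M.deg_congr hy).trans hx
      have h := outflow_add_le hM hT hdom hy5 hmax
      rw [← hy, M.sum_vert_eq, hy5]
      simp only [g, Finset.sum_add_distrib, Finset.sum_sub_distrib, Finset.sum_const,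
        Finset.card_range]
      rw [← Nat.cast_le (α := ℤ)] at h
      simp only [Nat.cast_add, Nat.cast_sum, Nat.cast_ofNat] at h
      norm_num
      linarith
    · have h := sum_sent_le hM hT hx
      rw [← M.vert_next x, M.sum_vert_eq, M.deg_congr (M.vert_next x)]
      simp only [g, Finset.sum_add_distrib, Finset.sum_sub_distrib, Finset.sum_const,
        Finset.card_range, nsmul_eq_mul]
      rw [← Nat.cast_le (α := ℤ)] at h
      simp only [Nat.cast_add, Nat.cast_sum, Nat.cast_mul, Nat.cast_ofNat] at h
      have h0 : (0 : ℤ) ≤ ∑ i ∈ Finset.range (M.deg x),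
          (M.sent (M.flip ((M.next ^ i) (M.next x))) : ℤ) :=
        Finset.sum_nonneg fun _ _ => Int.natCast_nonneg _
      linarith
  have htotal : ∑ x, g x = 120 * Fintype.card D := by
    have h : ∑ x, (M.sent (M.flip x) : ℤ) = ∑ x, (M.sent x : ℤ) :=
      Equiv.sum_comp M.flip fun x => (M.sent x : ℤ)
    simp only [g, Finset.sum_add_distrib, Finset.sum_sub_distrib, h, Finset.sum_const,
      Finset.card_univ, nsmul_eq_mul]
    ring
  have hge : (720 : ℤ) * Fintype.card V ≤ ∑ x, g x := by
    rw [← Finset.sum_fiberwise Finset.univ M.vert g]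
    have h := Finset.sum_le_sum fun v (_ : v ∈ Finset.univ) => hvert v
    simp only [Finset.sum_const, Finset.card_univ, nsmul_eq_mul] at h
    linarith
  have h1 := hM.euler
  have h2 := hM.three_mul_card_face_le
  omega

end Five

end CombMap

/-! ### The combinatorial map of a plane graph -/

namespace RotationSystem

variable {V : Type*} {G : SimpleGraph V}

/-- The combinatorial map of a rotation system without isolated vertices.  Its faces are the orbits
of the face-tracing permutation. -/
def toCombMap (R : RotationSystem G) (h : ∀ v, ∃ w, G.Adj v w) :
    CombMap G.Dart V (Quotient (Equiv.Perm.SameCycle.setoid R.facePerm)) where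
  flip := Function.Involutive.toPerm SimpleGraph.Dart.symm SimpleGraph.Dart.symm_involutive
  next := R.rot
  flip_flip := SimpleGraph.Dart.symm_symm
  vert d := d.fst
  vert_eq_iff d e := ⟨R.sameCycle_rot d e, by
    have hpow : ∀ (n : ℤ) d, ((R.rot ^ n) d).fst = d.fst := fun n d => by
      induction n with
      | zero => rfl
      | succ n ih => rw [add_comm, zpow_add, zpow_one, Equiv.Perm.mul_apply, R.fst_rot, ih]
      | pred n ih =>
        rw [← ih, ← R.fst_rot ((R.rot ^ (-(n : ℤ) - 1)) d), ← Equiv.Perm.mul_apply,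
          ← zpow_one_add, add_sub_cancel]
    rintro ⟨n, rfl⟩
    exact (hpow n d).symm⟩
  vert_surjective v := by
    obtain ⟨w, hw⟩ := h v
    exact ⟨⟨(v, w), hw⟩, rfl⟩
  face := Quotient.mk _
  face_next_flip d := Quotient.sound
    (Equiv.Perm.sameCycle_apply_left.2 (Equiv.Perm.SameCycle.refl R.facePerm d))
  face_surjective := Quotient.mk_surjective

variable (R : RotationSystem G) (h : ∀ v, ∃ w, G.Adj v w)

theorem deg_toCombMap [Fintype V] [DecidableRel G.Adj] (d : G.Dart) :
    (R.toCombMap h).deg d = G.degree d.fst := by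
  classical
  change Nat.card {e : G.Dart // e.fst = d.fst} = _
  rw [Nat.card_eq_fintype_card, Fintype.card_subtype, G.dart_fst_fiber_card_eq_degree]

theorem headDeg_toCombMap [Fintype V] [DecidableRel G.Adj] (d : G.Dart) :
    (R.toCombMap h).headDeg d = G.degree d.snd :=
  R.deg_toCombMap h d.symm

end RotationSystem

theorem theorem1 {V : Type*} [Fintype V] (G : SimpleGraph V) [DecidableRel G.Adj]
    (P : PlaneGraph G) (hG : G.minDegree = 5) :
    ∃ κ ∈ starTypes, P.toRotationSystem.HasStar κ := by
  classical
  have hdeg : ∀ v, 5 ≤ G.degree v := fun v => hG ▸ G.minDegree_le_degree v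
  have hadj : ∀ v, ∃ w, G.Adj v w := fun v => by
    have := hdeg v
    exact (G.degree_pos_iff_exists_adj v).1 (by omega)
  have hne : Nonempty V := by
    by_contra hV
    rw [not_nonempty_iff] at hV
    simp at hG
  let R := P.toRotationSystem
  let M := R.toCombMap hadj
  have hphi : ∀ d : G.Dart, (M.phi d).fst = d.snd := fun d => R.fst_rot d.symm
  have hM : M.Admissible := by
    refine ⟨fun d => ?_, fun d hd => ?_, fun d hd => ?_, ?_⟩
    · rw [R.deg_toCombMap]
      exact hdeg _
    · have := hphi d
      rw [hd] at this
      exact d.fst_ne_snd this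
    · -- a facial walk of length two would turn around at a vertex of degree one
      have h1 : d.fst = (M.phi d).snd := by rw [← hphi, hd]
      have h2 : M.phi d = d.symm := by
        ext
        · exact hphi d
        · exact h1.symm
      have h3 : M.deg d.symm = 1 := by
        rw [M.deg_eq_minimalPeriod, Function.minimalPeriod_eq_one_iff_isFixedPt]
        exact h2
      rw [R.deg_toCombMap] at h3
      have := hdeg d.symm.fst
      omega
    · have heuler := P.eulerGenus_eq_zero
      have hiso : IsEmpty {v : V // ∀ w : V, ¬ G.Adj v w} :=
        ⟨fun v => (hadj v.1).elim v.2⟩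
      have hcomp : 0 < Nat.card G.ConnectedComponent := by
        have : Nonempty G.ConnectedComponent := hne.map G.connectedComponentMk
        exact Nat.card_pos
      have hD := G.dart_card_eq_twice_card_edges
      have hE : Nat.card G.edgeSet = G.edgeFinset.card := by
        rw [Nat.card_eq_fintype_card, SimpleGraph.edgeFinset_card]
      have hF := Nat.card_eq_fintype_card
        (α := Quotient (Equiv.Perm.SameCycle.setoid R.facePerm))
      rw [RotationSystem.eulerGenus, RotationSystem.numFacialWalks, hE, hF,
        Nat.card_of_isEmpty (α := {v : V // ∀ w : V, ¬ G.Adj v w}),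
        Nat.card_eq_fintype_card (α := V)] at heuler
      omega
  obtain ⟨κ, hκ, d, hd, hstar⟩ := CombMap.exists_hasStar_of_triangulated
    (fun M hM hT => CombMap.exists_hasStar_of_triangulation hM hT) M hM
  refine ⟨κ, hκ, d, (R.deg_toCombMap hadj d).symm.trans hd, hstar.imp ?_ ?_⟩
  · exact fun h i => (R.headDeg_toCombMap hadj _) ▸ h i
  · exact fun h i => (R.headDeg_toCombMap hadj _) ▸ h i
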